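/- Let $k\ge 2$ and $d\ge 1$ be integers and let $\mathcal H=(\mathbb C^d)^{\otimes k}$ with computational basis $|i_1,\dots,i_k\rangle$. A state is a positive semidefinite operator on $\mathcal H$ of unit trace, and $\|X\|_1=\operatorname{Tr}\sqrt{X^*X}$. For states $\rho,\sigma$ let $F(\rho,\sigma)=\|\sqrt\rho\sqrt\sigma\|_1^2$ be the fidelity. For a state $\rho$ and a positive semidefinite operator $\sigma$ let $D(\rho\|\sigma)=\operatorname{Tr}[\rho(\log_2\rho-\log_2\sigma)]$ if $\operatorname{supp}\rho\subseteq\operatorname{supp}\sigma$ and $D(\rho\|\sigma)=+\infty$ otherwise. For $p,q:\mathcal X\to[0,\infty)$ on a finite set $\mathcal X$, let $D(p\|q)=\sum_x p(x)\log_2\frac{p(x)}{q(x)}$ if $\operatorname{supp}p\subseteq\operatorname{supp}q$ and $+\infty$ otherwise, with terms $p(x)=0$ counted as $0$. Let $h_2(p)=-p\log_2p-(1-p)\log_2(1-p)$, with $0\log_20=0$. Let $\Phi^d=\frac1d\sum_{i,j=0}^{d-1}|i\rangle\langle j|^{\otimes k}$ be the $k$-party GHZ state. Let $m$ range over the unordered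 bipartitions of the $k$ parties into two nonempty blocks, and let $T_m$ be the partial transpose, in the computational basis, on one of the two blocks of $m$ (the trace norm of $T_m(X)$ does not depend on which). The genuine multipartite Rains entanglement of a state $\rho$ is $$R(\rho)=\inf\Bigl\{D\Bigl(\rho\Big\|\sum_m r_m\omega_m\Bigr)+\log_2\Bigl(\sum_m r_m\|T_m(\omega_m)\|_1\Bigr)\Bigr\},$$ where the infimum is over all probability distributions $(r_m)_m$ and all families $(\omega_m)_m$ of states on $\mathcal H$. Let $\mathcal T$ be the set of operators $\tau=\sum_m q_m\tau_m$ with real $q_m\ge 0$, positive semidefinite $\tau_m$, and $\sum_m q_m\|T_m(\tau_m)\|_1\le 1$. For every state $\rho$ on $\mathcal H$ whose fidelity $F=F(\Phi^d,\rho)$ satisfies $F\ge 1/d$, $$R(\rho)\;\ge\; D\bigl((F,1-F)\,\big\|\,(1/d,1-1/d)\bigr)\;\ge\; F\log_2 d-h_2(F).$$ Moreover, $\operatorname{Tr}[\Phi^d\sigma]\le \frac1d$ for every $\sigma\in\mathcal T$. -/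

import Mathlib

namespace GMRE

open Matrix
open scoped ComplexOrder

noncomputable section

section General

variable {n : Type*} [Fintype n] [DecidableEq n]

/-- Quantum states: positive semidefinite operators of unit trace. -/
def IsState (ρ : Matrix n n ℂ) : Prop :=
  ρ.PosSemidef ∧ ρ.trace = 1

/-- The trace norm `Tr |X|`, where `|X| = √(X* X)`. -/
def traceNorm (X : Matrix n n ℂ) : ℝ :=
  (cfc Real.sqrt (Xᴴ * X)).trace.re

/-- The fidelity `‖√ρ √σ‖₁²`. -/
def fidelity (ρ σ : Matrix n n ℂ) : ℝ :=
  traceNorm (cfc Real.sqrt ρ * cfc Real.sqrt σ) ^ 2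

/-- The support of an operator: the orthogonal complement of its kernel. -/
def support (A : Matrix n n ℂ) : Submodule ℂ (EuclideanSpace ℂ n) :=
  (LinearMap.ker (Matrix.toEuclideanLin A))ᗮ

open Classical in
/-- The quantum relative entropy in base 2. The logarithm of a positive semidefinite operator is
taken on its support and extended by `0` on its kernel (`Real.logb 2 0 = 0`). -/
def quantumRelEntropy (ρ σ : Matrix n n ℂ) : EReal :=
  if support ρ ≤ support σ then
    (((ρ * (cfc (Real.logb 2) ρ - cfc (Real.logb 2) σ)).trace.re : ℝ) : EReal)
  else ⊤

open Classical in
/-- The classical relative entropy in base 2 of nonnegative functions on a finite alphabet; the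
terms with `p x = 0` vanish. -/
def classicalRelEntropy {X : Type*} [Fintype X] (p q : X → ℝ) : EReal :=
  if Function.support p ⊆ Function.support q then
    ((∑ x, p x * Real.logb 2 (p x / q x) : ℝ) : EReal)
  else ⊤

/-- The binary entropy in base 2. -/
def binaryEntropy (p : ℝ) : ℝ :=
  -p * Real.logb 2 p - (1 - p) * Real.logb 2 (1 - p)

end General

/-- Operators on `(ℂ^d)^{⊗k}`, as matrices in the computational basis `|a₀, …, a_{k-1}⟩`. -/
abbrev Op (k d : ℕ) : Type := Matrix (Fin k → Fin d) (Fin k → Fin d) ℂ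

/-- The unordered bipartitions `{S, Sᶜ}` of the `k` parties into two nonempty blocks. Each is
represented exactly once, by the block that does not contain party `0`. -/
abbrev Bipartition (k : ℕ) : Type :=
  {S : Finset (Fin k) // S.Nonempty ∧ ∀ i ∈ S, (i : ℕ) ≠ 0}

/-- The partial transpose on the parties in `S`, in the computational basis: the row and column
indices of these parties are exchanged. (Taking the complement of `S` instead gives the full
transpose of the result, which has the same trace norm.) -/
def partialTranspose {k d : ℕ} (S : Finset (Fin k)) (X : Op k d) : Op k d :=
  Matrix.of fun a b => X (S.piecewise b a) (S.piecewise a b)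

/-- The GHZ state `(1/d) ∑ i j, |i⟩⟨j|^{⊗k}`. -/
def ghz (k d : ℕ) : Op k d :=
  (1 / (d : ℂ)) • ∑ i : Fin d, ∑ j : Fin d, Matrix.single (fun _ => i) (fun _ => j) 1

/-- The genuine multipartite Rains entanglement: the infimum of
`D(ρ‖σ) + log₂ (∑ m, r m * ‖T_m (ω m)‖₁)` over all decompositions `σ = ∑ m, r m • ω m`, where `m`
ranges over the bipartitions, `r` is a probability distribution and each `ω m` is a state. -/
def gmre {k d : ℕ} (ρ : Op k d) : EReal :=
  sInf {x : EReal | ∃ (r : Bipartition k → ℝ) (ω : Bipartition k → Op k d),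
    (∀ m, 0 ≤ r m) ∧ ∑ m, r m = 1 ∧ (∀ m, IsState (ω m)) ∧
    x = quantumRelEntropy ρ (∑ m, r m • ω m) +
      ((Real.logb 2 (∑ m, r m * traceNorm (partialTranspose m.1 (ω m))) : ℝ) : EReal)}

/-- The set `T` of operators `∑ m, q m • τ m` with `q m ≥ 0`, `τ m ≥ 0` and
`∑ m, q m * ‖T_m (τ m)‖₁ ≤ 1`, where `m` ranges over the bipartitions. -/
def setT (k d : ℕ) : Set (Op k d) :=
  {τ | ∃ (q : Bipartition k → ℝ) (t : Bipartition k → Op k d),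
    (∀ m, 0 ≤ q m) ∧ (∀ m, (t m).PosSemidef) ∧ τ = ∑ m, q m • t m ∧
    ∑ m, q m * traceNorm (partialTranspose m.1 (t m)) ≤ 1}

end

end GMRE

namespace GMRE

open Matrix
open scoped ComplexOrder

/-! ### Spectral calculus and trace-norm duality -/

section General

variable {n : Type*} [Fintype n] [DecidableEq n]

/-! Measure `{Φ, 1 - Φ}`, with `Φ` the GHZ projection. As `Φ` has rank one, `F = Tr Φρ`. Across a
bipartition `m`, the partial transpose of `Φ` is `1/d` times a partial permutation matrix, so trace
duality gives `|Tr ΦX| ≤ ‖T_m X‖₁ / d` (`norm_trace_ghz_mul_le`). Summing over `m` bounds `Tr Φσ` on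
`T`, and gives `s = Tr Φσ ≤ N/d` for `σ = ∑ r_m ω_m` and `N = ∑ r_m ‖T_m ω_m‖₁ ≥ 1`.

By data processing (`binary_le_quantumRelEntropy`), `D(ρ‖σ)` is at least the binary relative entropy
of `(F, 1-F)` to `(s, 1-s)`. Enlarging `1-s` to `N-s` only lowers this, and adding `log N`
normalizes the second argument to `(s/N, 1-s/N)`. Since `s/N ≤ 1/d ≤ F`, moving `s/N` up to `1/d`
lowers it again (`binary_relEntropy_le`).

Data processing is proved directly for a two-outcome projective measurement: an integral
representation of the logarithm, in differential form, reduces it to an inequality between resolvent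
sums for each `t > 0`, which follows from a variational formula. -/

theorem exists_spectral_decomposition {A : Matrix n n ℂ} (hA : A.IsHermitian) :
    ∃ (U : Matrix n n ℂ) (l : n → ℝ), Uᴴ * U = 1 ∧ U * Uᴴ = 1 ∧
      A = U * diagonal (fun i => (l i : ℂ)) * Uᴴ ∧
      (∀ f : ℝ → ℝ, cfc f A = U * diagonal (fun i => (f (l i) : ℂ)) * Uᴴ) ∧
      (A.PosSemidef → ∀ i, 0 ≤ l i) := by
  refine ⟨hA.eigenvectorUnitary, hA.eigenvalues, ?_, ?_, ?_, ?_, fun h => h.eigenvalues_nonneg⟩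
  · exact Unitary.coe_star_mul_self hA.eigenvectorUnitary
  · exact Unitary.coe_mul_star_self hA.eigenvectorUnitary
  · conv_lhs => rw [hA.spectral_theorem]
    rfl
  · intro f
    rw [hA.cfc_eq f]
    rfl

/-- The spectrum lies in `{0, c}`, where `√x = x / √c`; if `c = 0`, both sides vanish. -/
theorem cfc_sqrt_of_mul_self_eq_smul {A : Matrix n n ℂ} (hA : A.IsHermitian) {c : ℝ} (hc : 0 ≤ c)
    (h : A * A = c • A) : cfc Real.sqrt A = (Real.sqrt c)⁻¹ • A := by
  have hs : IsSelfAdjoint A := hA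
  have hfin : (spectrum ℝ A).Finite := finite_real_spectrum
  have e : cfc (fun x : ℝ => x * x) A = cfc (fun x : ℝ => c * x) A := by
    rw [cfc_mul (fun x : ℝ => x) (fun x : ℝ => x) A, cfc_const_mul_id c A, cfc_id' ℝ A, h]
  have e' := (cfc_eq_cfc_iff_eqOn hs (by fun_prop) (by fun_prop)).1 e
  rw [← cfc_const_mul_id (Real.sqrt c)⁻¹ A]
  refine cfc_congr fun x hx => ?_
  have hx' : x * x = c * x := e' hx
  rcases mul_eq_mul_right_iff.1 hx' with rfl | rfl
  · rcases eq_or_lt_of_le hc with h0 | h0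
    · simp [← h0]
    · have := Real.sqrt_pos.2 h0
      rw [eq_inv_mul_iff_mul_eq₀ this.ne', Real.mul_self_sqrt hc]
  · simp

theorem trace_mul_conjTranspose_re {m : Type*} [Fintype m] (w : n → ℝ) (Z : Matrix n m ℂ) :
    (diagonal (fun i => (w i : ℂ)) * Z * Zᴴ).trace.re = ∑ i, ∑ j, w i * ‖Z i j‖ ^ 2 := by
  simp only [trace, diag_apply, mul_apply (M := _ * _), diagonal_mul, Complex.re_sum,
    conjTranspose_apply]
  refine Finset.sum_congr rfl fun i _ => Finset.sum_congr rfl fun j _ => ?_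
  rw [mul_assoc, Complex.star_def, Complex.mul_conj, ← Complex.ofReal_mul, Complex.ofReal_re,
    Complex.normSq_eq_norm_sq]

theorem conjTranspose_mul_self_apply {n : Type*} [Fintype n] (Z : Matrix n n ℂ) (i : n) :
    (Zᴴ * Z) i i = ((∑ j, ‖Z j i‖ ^ 2 : ℝ) : ℂ) := by
  simp only [mul_apply, conjTranspose_apply, Complex.ofReal_sum]
  refine Finset.sum_congr rfl fun j _ => ?_
  rw [Complex.star_def, ← Complex.normSq_eq_conj_mul_self, Complex.normSq_eq_norm_sq]

/-- Trace duality between contractions and the trace norm. -/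
theorem norm_trace_mul_le_traceNorm {V : Matrix n n ℂ} (hV : (1 - V * Vᴴ).PosSemidef)
    (X : Matrix n n ℂ) : ‖(V * X).trace‖ ≤ traceNorm X := by
  obtain ⟨U, l, hU, hU', hX, hf, hl⟩ :=
    exists_spectral_decomposition (posSemidef_conjTranspose_mul_self X).isHermitian
  have hl := hl (posSemidef_conjTranspose_mul_self X)
  have hN : traceNorm X = ∑ i, Real.sqrt (l i) := by
    rw [traceNorm, hf, mul_assoc, trace_mul_comm, mul_assoc, hU, mul_one, trace_diagonal,
      Complex.re_sum]
    rfl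
  -- Rows of `Uᴴ V` have norm at most 1 and columns of `X U` have norm `√l i`, so Cauchy–Schwarz
  -- applies index by index.
  have hA : ∀ i, ∑ j, ‖(Uᴴ * V) i j‖ ^ 2 ≤ 1 := by
    intro i
    have h1 := (hV.conjTranspose_mul_mul_same U).diag_nonneg (i := i)
    have h2 : Uᴴ * (1 - V * Vᴴ) * U = 1 - (Vᴴ * U)ᴴ * (Vᴴ * U) := by
      rw [mul_sub, sub_mul, mul_one, hU, conjTranspose_mul, conjTranspose_conjTranspose]
      simp only [mul_assoc]
    rw [h2, Matrix.sub_apply, one_apply_eq, conjTranspose_mul_self_apply, ← Complex.ofReal_one,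
      ← Complex.ofReal_sub, Complex.zero_le_real, sub_nonneg] at h1
    refine le_trans (le_of_eq (Finset.sum_congr rfl fun j _ => ?_)) h1
    have : (Vᴴ * U) j i = star ((Uᴴ * V) i j) := by
      rw [← conjTranspose_apply, conjTranspose_mul, conjTranspose_conjTranspose]
    rw [this, norm_star]
  have hB : ∀ i, ∑ j, ‖(X * U) j i‖ ^ 2 = l i := by
    intro i
    have h1 : (X * U)ᴴ * (X * U) = diagonal (fun i => (l i : ℂ)) := by
      rw [conjTranspose_mul, show Uᴴ * Xᴴ * (X * U) = Uᴴ * (Xᴴ * X) * U by simp only [mul_assoc],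
        hX, show Uᴴ * (U * diagonal (fun i => (l i : ℂ)) * Uᴴ) * U
          = (Uᴴ * U) * diagonal (fun i => (l i : ℂ)) * (Uᴴ * U) by simp only [mul_assoc], hU,
        one_mul, mul_one]
    have h2 := conjTranspose_mul_self_apply (X * U) i
    rw [h1, diagonal_apply_eq] at h2
    exact_mod_cast h2.symm
  have hT : (V * X).trace = ∑ i, ∑ j, (Uᴴ * V) i j * (X * U) j i := by
    have : (V * X).trace = ((Uᴴ * V) * (X * U)).trace := by
      rw [show (Uᴴ * V) * (X * U) = Uᴴ * (V * X) * U by simp only [mul_assoc],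
        trace_mul_comm _ U, ← mul_assoc, hU', one_mul]
    rw [this]
    simp [trace, mul_apply]
  rw [hT, hN]
  refine (norm_sum_le _ _).trans (Finset.sum_le_sum fun i _ => (norm_sum_le _ _).trans ?_)
  simp only [norm_mul]
  refine (Real.sum_mul_le_sqrt_mul_sqrt _ _ _).trans ?_
  rw [hB i]
  exact mul_le_of_le_one_left (Real.sqrt_nonneg _) (Real.sqrt_le_one.2 (hA i))

/-! ### Data processing for a binary measurement -/

/-- The hypothesis makes `g t = ∑ c (log (q + t p) - log q)` nondecreasing from `g 0 = 0`. Because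
`∑ c = 0`, a factor `t` can be pulled out of each logarithm for free, and `t → ∞` gives the claim.
-/
theorem sum_mul_log_sub_log_nonneg {ι : Type*} [Fintype ι] (c p q : ι → ℝ)
    (hpq : ∀ i, c i ≠ 0 → 0 < p i ∧ 0 < q i) (hc : ∑ i, c i = 0)
    (h : ∀ t, 0 < t → 0 ≤ ∑ i, c i * (p i / (q i + t * p i))) :
    0 ≤ ∑ i, c i * (Real.log (p i) - Real.log (q i)) := by
  set g : ℝ → ℝ := fun t => ∑ i, c i * (Real.log (q i + t * p i) - Real.log (q i)) with hg
  have hd : ∀ t, 0 ≤ t → HasDerivAt g (∑ i, c i * (p i / (q i + t * p i))) t := by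
    intro t ht
    refine HasDerivAt.fun_sum fun i _ => ?_
    by_cases hi : c i = 0
    · simpa [hi] using hasDerivAt_const t (0 : ℝ)
    · obtain ⟨h1, h2⟩ := hpq i hi
      have h3 : q i + t * p i ≠ 0 := by positivity
      have h4 : HasDerivAt (fun t => q i + t * p i) (p i) t := by
        simpa using ((hasDerivAt_id t).mul_const (p i)).const_add (q i)
      exact ((h4.log h3).sub_const _).const_mul _
  have hmono : MonotoneOn g (Set.Ici 0) := by
    refine monotoneOn_of_deriv_nonneg (convex_Ici 0)
      (fun t ht => (hd t ht).continuousAt.continuousWithinAt)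
      (fun t ht => (hd t (interior_subset ht)).differentiableAt.differentiableWithinAt)
      fun t ht => ?_
    rw [interior_Ici] at ht
    rw [(hd t (le_of_lt ht)).deriv]
    exact h t ht
  have hg0 : g 0 = 0 := by simp [hg]
  have hpos : ∀ t, 0 < t → 0 ≤ ∑ i, c i * (Real.log (q i * t⁻¹ + p i) - Real.log (q i)) := by
    intro t ht
    have h1 : 0 ≤ g t := hg0 ▸ hmono (Set.mem_Ici.2 le_rfl) (Set.mem_Ici.2 ht.le) ht.le
    have h2 : ∑ i, c i * (Real.log (q i * t⁻¹ + p i) - Real.log (q i))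
        = g t - (∑ i, c i) * Real.log t := by
      rw [hg, Finset.sum_mul, ← Finset.sum_sub_distrib]
      refine Finset.sum_congr rfl fun i _ => ?_
      by_cases hi : c i = 0
      · simp [hi]
      · obtain ⟨h1, h2⟩ := hpq i hi
        have h3 : q i + t * p i = t * (q i * t⁻¹ + p i) := by field_simp
        rw [h3, Real.log_mul ht.ne' (by positivity)]
        ring
    rw [h2, hc]
    simpa using h1
  have hlim : Filter.Tendsto (fun t : ℝ => ∑ i, c i * (Real.log (q i * t⁻¹ + p i) - Real.log (q i)))
      Filter.atTop (nhds (∑ i, c i * (Real.log (p i) - Real.log (q i)))) := by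
    refine tendsto_finsetSum _ fun i _ => ?_
    by_cases hi : c i = 0
    · simp [hi]
    · have h1 : Filter.Tendsto (fun t : ℝ => q i * t⁻¹ + p i) Filter.atTop (nhds (p i)) := by
        simpa using (tendsto_inv_atTop_zero.const_mul (q i)).add_const (p i)
      exact ((h1.log (hpq i hi).1.ne').sub_const _).const_mul _
  exact ge_of_tendsto hlim ((Filter.eventually_gt_atTop 0).mono hpos)

/-- Completing the square in `z`, with optimum `z = p c / (q + t p)`. The case `p = 0` is separate
since the denominator may vanish. -/
theorem re_mul_sub_le_div (p q t : ℝ) (hp : 0 ≤ p) (hq : 0 ≤ q) (ht : 0 < t) (c z : ℂ) :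
    2 * (p * (star c * z).re) - (q * ‖z‖ ^ 2 + t * (p * ‖z‖ ^ 2)) ≤
      p * ‖c‖ ^ 2 * (p / (q + t * p)) := by
  have hre : (star c * z).re ≤ ‖c‖ * ‖z‖ := by
    calc (star c * z).re ≤ ‖star c * z‖ := Complex.re_le_norm _
      _ = _ := by rw [norm_mul, norm_star]
  rcases eq_or_lt_of_le hp with rfl | hp
  · have : 0 ≤ q * ‖z‖ ^ 2 := by positivity
    simpa using this
  · have hD : 0 < q + t * p := by positivity
    rw [mul_div_assoc', le_div_iff₀ hD]
    nlinarith [sq_nonneg (p * ‖c‖ - (q + t * p) * ‖z‖),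
      mul_le_mul_of_nonneg_left hre (mul_pos hp hD).le]

theorem diagonal_mul_trace_re (p : n → ℝ) (C Z : Matrix n n ℂ) :
    (diagonal (fun i => (p i : ℂ)) * Cᴴ * Z).trace.re =
      ∑ i, ∑ j, p i * (star (C j i) * Z j i).re := by
  simp only [trace, diag_apply, mul_apply (M := _ * _), diagonal_mul, Complex.re_sum,
    conjTranspose_apply]
  refine Finset.sum_congr rfl fun i _ => Finset.sum_congr rfl fun j _ => ?_
  rw [mul_assoc, Complex.re_ofReal_mul]

theorem mulVec_eq_zero_of_support_le {ρ σ : Matrix n n ℂ} (h : support ρ ≤ support σ) (v : n → ℂ)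
    (hv : σ *ᵥ v = 0) : ρ *ᵥ v = 0 := by
  have h1 := Submodule.orthogonal_le h
  rw [support, support, Submodule.orthogonal_orthogonal, Submodule.orthogonal_orthogonal] at h1
  have h2 : WithLp.toLp 2 v ∈ LinearMap.ker (Matrix.toEuclideanLin σ) := by
    simp [hv]
  simpa using h1 h2

/-- Binary data processing for the quantum relative entropy. -/
theorem binary_le_quantumRelEntropy {ρ σ P : Matrix n n ℂ} (hρ : IsState ρ) (hσ : σ.PosSemidef)
    (hP : P.IsHermitian) (hPP : P * P = P) {F x y : ℝ} (hF : (P * ρ).trace.re = F)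
    (hF0 : 0 ≤ F) (hF1 : F ≤ 1)
    (hx : 0 < x) (hy : 0 < y) (hPx : (P * σ).trace.re ≤ x) (hPy : ((1 - P) * σ).trace.re ≤ y) :
    ((F * Real.logb 2 (F / x) + (1 - F) * Real.logb 2 ((1 - F) / y) : ℝ) : EReal) ≤
      quantumRelEntropy ρ σ := by
  rw [quantumRelEntropy]
  split_ifs with hsupp
  swap
  · exact le_top
  have hker := mulVec_eq_zero_of_support_le hsupp
  obtain ⟨U, p, hU, hU', hρU, hfρ, hp⟩ := exists_spectral_decomposition hρ.1.isHermitian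
  obtain ⟨V, q, hV, hV', hσV, hfσ, hq⟩ := exists_spectral_decomposition hσ.isHermitian
  replace hp := hp hρ.1
  replace hq := hq hσ
  set C : Matrix n n ℂ := Vᴴ * U with hC
  have hCC : Cᴴ * C = 1 := by
    rw [hC, conjTranspose_mul, conjTranspose_conjTranspose, mul_assoc, ← mul_assoc V, hV', one_mul,
      hU]
  -- The support condition removes all weight from pairs with `q j = 0`, so the convention `logb 2 0
  -- = 0` does no harm.
  have hzero : ∀ i j, q j = 0 → p i * ‖C j i‖ ^ 2 = 0 := by
    intro i j hqj
    have h1 : σ *ᵥ (V *ᵥ Pi.single j 1) = 0 := by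
      rw [mulVec_mulVec, hσV, mul_assoc, hV, mul_one, ← mulVec_mulVec, diagonal_mulVec_single, hqj]
      simp
    have h2 := hker _ h1
    have h3 : Uᴴ *ᵥ (ρ *ᵥ (V *ᵥ Pi.single j 1)) = 0 := by rw [h2, mulVec_zero]
    have h4 : Uᴴ * (ρ * V) = diagonal (fun i => (p i : ℂ)) * Cᴴ := by
      rw [hρU, hC, conjTranspose_mul, conjTranspose_conjTranspose,
        show Uᴴ * (U * diagonal (fun i => (p i : ℂ)) * Uᴴ * V)
          = Uᴴ * U * (diagonal (fun i => (p i : ℂ)) * (Uᴴ * V)) by simp only [mul_assoc], hU,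
        one_mul]
    rw [mulVec_mulVec, mulVec_mulVec, mul_assoc, h4, mulVec_single_one] at h3
    have h5 := congrFun h3 i
    simp only [col_apply, diagonal_mul, conjTranspose_apply, Pi.zero_apply, mul_eq_zero,
      Complex.ofReal_eq_zero, star_eq_zero] at h5
    rcases h5 with h5 | h5 <;> simp [h5]
  have hcol : ∀ i, ∑ j, ‖C j i‖ ^ 2 = 1 := by
    intro i
    have := conjTranspose_mul_self_apply C i
    rw [hCC, one_apply_eq] at this
    exact_mod_cast this.symm
  have htr : ∑ i, p i = 1 := by
    have h1 := hρ.2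
    rw [hρU, mul_assoc, trace_mul_comm, mul_assoc, hU, mul_one, trace_diagonal] at h1
    exact_mod_cast h1
  -- The Nussbaum–Szkoła form: a classical relative entropy of `p i * ‖C j i‖ ^ 2` to `q j * ‖C j i‖
  -- ^ 2`.
  have hD : (ρ * (cfc (Real.logb 2) ρ - cfc (Real.logb 2) σ)).trace.re
      = ∑ i, ∑ j, p i * ‖C j i‖ ^ 2 * (Real.logb 2 (p i) - Real.logb 2 (q j)) := by
    have h1 : (ρ * cfc (Real.logb 2) ρ).trace.re = ∑ i, p i * Real.logb 2 (p i) := by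
      rw [hfρ]
      conv_lhs => rw [hρU]
      rw [show U * diagonal (fun i => (p i : ℂ)) * Uᴴ *
          (U * diagonal (fun i => (Real.logb 2 (p i) : ℂ)) * Uᴴ)
        = U * (diagonal (fun i => (p i : ℂ)) * (Uᴴ * U) *
          diagonal (fun i => (Real.logb 2 (p i) : ℂ)) * Uᴴ) by simp only [mul_assoc],
        trace_mul_comm, mul_assoc, hU, mul_one, mul_one, diagonal_mul_diagonal, trace_diagonal,
        Complex.re_sum]
      refine Finset.sum_congr rfl fun i _ => ?_
      rw [← Complex.ofReal_mul, Complex.ofReal_re]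
    have h2 : (ρ * cfc (Real.logb 2) σ).trace.re
        = ∑ i, ∑ j, p i * (‖C j i‖ ^ 2 * Real.logb 2 (q j)) := by
      have : (ρ * cfc (Real.logb 2) σ).trace = (diagonal (fun i => (p i : ℂ)) * Cᴴ *
          (diagonal (fun j => (Real.logb 2 (q j) : ℂ)) * C)).trace := by
        rw [hfσ]
        conv_lhs => rw [hρU]
        rw [hC, conjTranspose_mul, conjTranspose_conjTranspose,
          show U * diagonal (fun i => (p i : ℂ)) * Uᴴ *
            (V * diagonal (fun j => (Real.logb 2 (q j) : ℂ)) * Vᴴ)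
          = U * (diagonal (fun i => (p i : ℂ)) * Uᴴ *
            (V * diagonal (fun j => (Real.logb 2 (q j) : ℂ)) * Vᴴ)) by simp only [mul_assoc],
          trace_mul_comm]
        simp only [mul_assoc]
      rw [this, diagonal_mul_trace_re]
      refine Finset.sum_congr rfl fun i _ => Finset.sum_congr rfl fun j _ => ?_
      rw [diagonal_mul, mul_left_comm, Complex.star_def, ← Complex.normSq_eq_conj_mul_self,
        ← Complex.ofReal_mul, Complex.ofReal_re, Complex.normSq_eq_norm_sq]
      ring
    rw [mul_sub, trace_sub, Complex.sub_re, h1, h2, ← Finset.sum_sub_distrib]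
    refine Finset.sum_congr rfl fun i _ => ?_
    calc p i * Real.logb 2 (p i) - ∑ j, p i * (‖C j i‖ ^ 2 * Real.logb 2 (q j))
        = (∑ j, ‖C j i‖ ^ 2) * (p i * Real.logb 2 (p i))
          - ∑ j, p i * (‖C j i‖ ^ 2 * Real.logb 2 (q j)) := by rw [hcol, one_mul]
      _ = _ := by
        rw [Finset.sum_mul, ← Finset.sum_sub_distrib]
        exact Finset.sum_congr rfl fun j _ => by ring
  -- Every Hermitian test operator `Y` bounds the resolvent sum from below.
  have hvar : ∀ t, 0 < t → ∀ Y : Matrix n n ℂ, Y.IsHermitian →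
      2 * (Y * ρ).trace.re - ((Y * Y * σ).trace.re + t * (Y * Y * ρ).trace.re) ≤
        ∑ i, ∑ j, p i * ‖C j i‖ ^ 2 * (p i / (q j + t * p i)) := by
    intro t ht Y hY
    set Z : Matrix n n ℂ := Vᴴ * Y * U with hZ
    have e1 : (Y * ρ).trace.re = ∑ i, ∑ j, p i * (star (C j i) * Z j i).re := by
      rw [← diagonal_mul_trace_re, hZ, hC, conjTranspose_mul, conjTranspose_conjTranspose]
      conv_lhs => rw [hρU]
      rw [show diagonal (fun i => (p i : ℂ)) * (Uᴴ * V) * (Vᴴ * Y * U)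
        = diagonal (fun i => (p i : ℂ)) * Uᴴ * (V * Vᴴ) * Y * U by simp only [mul_assoc], hV',
        mul_one, trace_mul_comm Y, mul_assoc U, mul_assoc U, trace_mul_comm U]
    have e2 : (Y * Y * σ).trace.re = ∑ i, ∑ j, q j * ‖Z j i‖ ^ 2 := by
      rw [Finset.sum_comm, ← trace_mul_conjTranspose_re, hZ]
      conv_lhs => rw [hσV]
      rw [conjTranspose_mul, conjTranspose_mul, conjTranspose_conjTranspose, hY.eq,
        show diagonal (fun i => (q i : ℂ)) * (Vᴴ * Y * U) * (Uᴴ * (Y * V))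
        = diagonal (fun i => (q i : ℂ)) * Vᴴ * Y * (U * Uᴴ) * Y * V by simp only [mul_assoc], hU',
        mul_one, trace_mul_comm (Y * Y), mul_assoc V, mul_assoc V, trace_mul_comm V]
      simp only [mul_assoc]
    have e3 : (Y * Y * ρ).trace.re = ∑ i, ∑ j, p i * ‖Z j i‖ ^ 2 := by
      have : ∑ i, ∑ j, p i * ‖Z j i‖ ^ 2 = ∑ i, ∑ j, p i * ‖Zᴴ i j‖ ^ 2 := by
        simp only [conjTranspose_apply, norm_star]
      rw [this, ← trace_mul_conjTranspose_re, hZ]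
      conv_lhs => rw [hρU]
      rw [conjTranspose_conjTranspose, conjTranspose_mul, conjTranspose_mul,
        conjTranspose_conjTranspose, hY.eq,
        show diagonal (fun i => (p i : ℂ)) * (Uᴴ * (Y * V)) * (Vᴴ * Y * U)
        = diagonal (fun i => (p i : ℂ)) * Uᴴ * Y * (V * Vᴴ) * Y * U by simp only [mul_assoc], hV',
        mul_one, trace_mul_comm (Y * Y), mul_assoc U, mul_assoc U, trace_mul_comm U]
      simp only [mul_assoc]
    rw [e1, e2, e3]
    simp only [Finset.mul_sum, ← Finset.sum_add_distrib, ← Finset.sum_sub_distrib]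
    exact Finset.sum_le_sum fun i _ => Finset.sum_le_sum fun j _ =>
      re_mul_sub_le_div _ _ _ (hp i) (hq j) ht _ _
  have hbin : ∀ t, 0 < t → F * (F / (x + t * F)) + (1 - F) * ((1 - F) / (y + t * (1 - F))) ≤
      ∑ i, ∑ j, p i * ‖C j i‖ ^ 2 * (p i / (q j + t * p i)) := by
    intro t ht
    have hG0 : 0 ≤ 1 - F := sub_nonneg.2 hF1
    have hxF : 0 < x + t * F := by positivity
    have hyF : 0 < y + t * (1 - F) := by positivity
    -- On operators `a P + b (1 - P)` the bound splits into two scalar quadratics; these are their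
    -- maximizers with `x`, `y` in place of the traces of `σ`.
    set a := F / (x + t * F) with ha
    set b := (1 - F) / (y + t * (1 - F)) with hb
    have haF : a * (x + t * F) = F := div_mul_cancel₀ _ hxF.ne'
    have hbF : b * (y + t * (1 - F)) = 1 - F := div_mul_cancel₀ _ hyF.ne'
    have h1P : ((1 - P) * ρ).trace.re = 1 - F := by
      rw [sub_mul, one_mul, trace_sub, hρ.2, Complex.sub_re, hF, Complex.one_re]
    have hY : (a • P + b • (1 - P)).IsHermitian := by
      have h1 : (1 - P).IsHermitian := isHermitian_one.sub hP
      rw [IsHermitian, conjTranspose_add, conjTranspose_smul, conjTranspose_smul, hP.eq, h1.eq,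
        star_trivial, star_trivial]
    have hYY : (a • P + b • (1 - P)) * (a • P + b • (1 - P)) = (a ^ 2) • P + (b ^ 2) • (1 - P) := by
      rw [sq a, sq b]
      simp only [add_mul, mul_add, smul_mul_assoc, mul_smul_comm, mul_sub, sub_mul, one_mul,
        mul_one, hPP, sub_self, smul_zero, add_zero, smul_smul]
      rw [add_sub_cancel_left, smul_smul]
    have hlin : ∀ (u v : ℝ) (M : Matrix n n ℂ), ((u • P + v • (1 - P)) * M).trace.re
        = u * (P * M).trace.re + v * ((1 - P) * M).trace.re := by
      intro u v M
      rw [add_mul, smul_mul_assoc, smul_mul_assoc, trace_add, trace_smul, trace_smul,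
        Complex.add_re, Complex.real_smul, Complex.real_smul, Complex.re_ofReal_mul,
        Complex.re_ofReal_mul]
    refine le_trans ?_ (hvar t ht _ hY)
    rw [hYY, hlin, hlin, hlin, hF, h1P]
    nlinarith [mul_le_mul_of_nonneg_left hPx (sq_nonneg a),
      mul_le_mul_of_nonneg_left hPy (sq_nonneg b), congrArg (a * ·) haF, congrArg (b * ·) hbF]
  -- Quantum and binary terms form one family, with weights of opposite sign and total zero.
  have hlog := sum_mul_log_sub_log_nonneg (ι := (n × n) ⊕ Fin 2)
    (Sum.elim (fun a => p a.1 * ‖C a.2 a.1‖ ^ 2) ![-F, -(1 - F)])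
    (Sum.elim (fun a => p a.1) ![F, 1 - F]) (Sum.elim (fun a => q a.2) ![x, y]) ?_ ?_ ?_
  · rw [hD, EReal.coe_le_coe_iff]
    simp only [Fintype.sum_sum_type, Sum.elim_inl, Sum.elim_inr, Fin.sum_univ_two,
      Fintype.sum_prod_type, cons_val_zero, cons_val_one] at hlog
    have hl2 : 0 < Real.log 2 := Real.log_pos (by norm_num)
    have e1 : F * Real.logb 2 (F / x) = F * (Real.log F - Real.log x) / Real.log 2 := by
      rcases eq_or_ne F 0 with h | h
      · simp [h]
      · rw [Real.logb, Real.log_div h hx.ne', mul_div_assoc]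
    have e2 : (1 - F) * Real.logb 2 ((1 - F) / y)
        = (1 - F) * (Real.log (1 - F) - Real.log y) / Real.log 2 := by
      rcases eq_or_ne (1 - F) 0 with h | h
      · simp [h]
      · rw [Real.logb, Real.log_div h hy.ne', mul_div_assoc]
    have e3 : ∑ i, ∑ j, p i * ‖C j i‖ ^ 2 * (Real.logb 2 (p i) - Real.logb 2 (q j))
        = (∑ i, ∑ j, p i * ‖C j i‖ ^ 2 * (Real.log (p i) - Real.log (q j))) / Real.log 2 := by
      simp only [Finset.sum_div, Real.logb]
      exact Finset.sum_congr rfl fun i _ => Finset.sum_congr rfl fun j _ => by ring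
    rw [e1, e2, e3, ← add_div]
    exact div_le_div_of_nonneg_right (by linarith) hl2.le
  · rintro (⟨i, j⟩ | i) hi
    · simp only [Sum.elim_inl] at hi ⊢
      exact ⟨(hp i).lt_of_ne' fun h => hi (by simp [h]),
        (hq j).lt_of_ne' fun h => hi (hzero i j h)⟩
    · fin_cases i
      · simp at hi ⊢
        exact ⟨hF0.lt_of_ne' hi, hx⟩
      · simp at hi ⊢
        exact ⟨lt_of_le_of_ne hF1 fun h => hi (by linarith), hy⟩
  · simp only [Fintype.sum_sum_type, Sum.elim_inl, Sum.elim_inr, Fin.sum_univ_two,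
      Fintype.sum_prod_type, cons_val_zero, cons_val_one, ← Finset.mul_sum, hcol, mul_one, htr]
    ring
  · intro t ht
    have := hbin t ht
    simp only [Fintype.sum_sum_type, Sum.elim_inl, Sum.elim_inr, Fin.sum_univ_two,
      Fintype.sum_prod_type, cons_val_zero, cons_val_one]
    linarith

end General

/-! ### Projections, supports and fidelity -/

section Projections

variable {n : Type*} [Fintype n] [DecidableEq n]

theorem trace_projection_mul_nonneg {n : Type*} [Fintype n] {P ρ : Matrix n n ℂ} (hP : P.IsHermitian) (hPP : P * P = P)
    (hρ : ρ.PosSemidef) : 0 ≤ (P * ρ).trace := by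
  have h := (hρ.mul_mul_conjTranspose_same P).trace_nonneg
  rwa [hP.eq, trace_mul_comm, ← mul_assoc, hPP] at h

/-- If `Tr Pσ = 0`, then `P σ P = 0`, so `σ` kills the range of `P`; by the support inclusion so
does `ρ`. -/
theorem trace_projection_mul_pos {P ρ σ : Matrix n n ℂ} (hP : P.IsHermitian) (hPP : P * P = P)
    (hσ : σ.PosSemidef) (h : support ρ ≤ support σ) (hρ : 0 < (P * ρ).trace.re) :
    0 < (P * σ).trace.re := by
  have h0 := trace_projection_mul_nonneg hP hPP hσ
  refine lt_of_le_of_ne (Complex.le_def.1 h0).1 fun hs => hρ.ne' ?_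
  have hs' : (P * σ).trace = 0 := Complex.ext hs.symm (Complex.le_def.1 h0).2.symm
  have h1 : P * σ * Pᴴ = 0 := by
    rw [← (hσ.mul_mul_conjTranspose_same P).trace_eq_zero_iff, hP.eq, trace_mul_comm, ← mul_assoc,
      hPP, hs']
  have h2 : ρ * P = 0 := by
    refine Matrix.toLin'.injective (LinearMap.ext fun v => ?_)
    simp only [toLin'_apply, zero_mulVec]
    rw [← mulVec_mulVec]
    refine mulVec_eq_zero_of_support_le h _ ((hσ.dotProduct_mulVec_zero_iff _).1 ?_)
    rw [star_mulVec, hP.eq, ← dotProduct_mulVec, mulVec_mulVec, mulVec_mulVec]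
    rw [hP.eq] at h1
    rw [h1, zero_mulVec, dotProduct_zero]
  rw [trace_mul_comm, h2, trace_zero, Complex.zero_re]

/-- With `c = Tr Pρ`, the operator `A = √ρ P √ρ` satisfies `A² = c A` and `Tr A = c`, so `Tr √A =
√c`. -/
theorem fidelity_of_rank_one {P ρ : Matrix n n ℂ} (hP : P.IsHermitian) (hPP : P * P = P)
    (hP1 : ∀ M, P * M * P = (P * M).trace • P) (hρ : ρ.PosSemidef) :
    fidelity P ρ = (P * ρ).trace.re := by
  have h0 := trace_projection_mul_nonneg hP hPP hρ
  set c : ℝ := (P * ρ).trace.re with hc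
  have hc0 : 0 ≤ c := (Complex.le_def.1 h0).1
  have hcc : (P * ρ).trace = (c : ℂ) := Complex.ext rfl (by simpa using (Complex.le_def.1 h0).2.symm)
  have hsP : cfc Real.sqrt P = P := by
    simpa using cfc_sqrt_of_mul_self_eq_smul hP zero_le_one (by simpa using hPP)
  obtain ⟨U, l, hU, hU', hρU, hf, hl⟩ := exists_spectral_decomposition hρ.isHermitian
  replace hl := hl hρ
  set S := cfc Real.sqrt ρ with hS
  have hSh : Sᴴ = S := IsSelfAdjoint.cfc
  have hSS : S * S = ρ := by
    rw [hS, hf, show ∀ D : Matrix n n ℂ, U * D * Uᴴ * (U * D * Uᴴ) = U * (D * (Uᴴ * U) * D) * Uᴴ by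
      intro D; simp only [mul_assoc], hU, mul_one, diagonal_mul_diagonal]
    conv_rhs => rw [hρU]
    congr 3
    ext i
    rw [← Complex.ofReal_mul, Real.mul_self_sqrt (hl i)]
  have hA : (P * S)ᴴ * (P * S) = S * P * S := by
    rw [conjTranspose_mul, hP.eq, hSh, mul_assoc, ← mul_assoc P, hPP, ← mul_assoc]
  have hAA : S * P * S * (S * P * S) = c • (S * P * S) := by
    rw [show S * P * S * (S * P * S) = S * (P * (S * S) * P) * S by simp only [mul_assoc], hSS, hP1,
      hcc, mul_smul_comm, smul_mul_assoc, Complex.coe_smul]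
  have hAt : (S * P * S).trace = c := by
    rw [trace_mul_comm, ← mul_assoc, hSS, trace_mul_comm, hcc]
  have hAh : (S * P * S).IsHermitian := hA ▸ isHermitian_conjTranspose_mul_self (P * S)
  rw [fidelity, hsP, traceNorm, hA, cfc_sqrt_of_mul_self_eq_smul hAh hc0 hAA, trace_smul, hAt,
    Complex.real_smul, ← Complex.ofReal_mul, Complex.ofReal_re]
  rcases eq_or_lt_of_le hc0 with h | h
  · simp [← h]
  · rw [mul_pow, inv_pow, Real.sq_sqrt hc0]
    field_simp

end Projections

/-! ### The GHZ projection and its partial transposes -/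

section GHZ

variable {k d : ℕ}

theorem ghz_eq_vecMulVec :
    ghz k d = (1 / (d : ℂ)) • vecMulVec (∑ i : Fin d, Pi.single (fun _ => i) 1)
      (∑ i : Fin d, Pi.single (fun _ => i) 1) := by
  rw [ghz]
  congr 1
  ext a b
  simp only [Matrix.sum_apply, vecMulVec_apply, Finset.sum_apply, Finset.sum_mul_sum]
  refine Finset.sum_congr rfl fun i _ => Finset.sum_congr rfl fun j _ => ?_
  simp only [single_apply, Pi.single_apply, eq_comm (a := a), eq_comm (a := b)]
  split_ifs <;> simp_all

theorem const_injective (hk : 2 ≤ k) : Function.Injective (fun (i : Fin d) (_ : Fin k) => i) :=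
  fun _ _ h => congrFun h ⟨0, by omega⟩

theorem ghz_dotProduct (hk : 2 ≤ k) :
    (∑ i : Fin d, Pi.single (fun _ : Fin k => i) (1 : ℂ)) ⬝ᵥ
      (∑ i : Fin d, Pi.single (fun _ => i) 1) = d := by
  simp [sum_dotProduct, Pi.single_apply, (const_injective hk).eq_iff]

theorem ghz_isHermitian : (ghz k d).IsHermitian := by
  rw [IsHermitian, ghz_eq_vecMulVec, conjTranspose_smul, conjTranspose_vecMulVec]
  simp [Pi.star_single]

theorem ghz_mul_mul_ghz (M : Op k d) : ghz k d * M * ghz k d = (ghz k d * M).trace • ghz k d := by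
  rw [ghz_eq_vecMulVec]
  simp only [smul_mul_assoc, mul_smul_comm, vecMulVec_mul, vecMul_vecMulVec, trace_smul,
    trace_vecMulVec, vecMulVec_smul, smul_smul, smul_eq_mul]
  rw [dotProduct_comm, mul_right_comm, mul_assoc]

theorem ghz_mul_self (hk : 2 ≤ k) (hd : 1 ≤ d) : ghz k d * ghz k d = ghz k d := by
  have hd' : (d : ℂ) ≠ 0 := by exact_mod_cast (by omega : d ≠ 0)
  rw [ghz_eq_vecMulVec, smul_mul_assoc, mul_smul_comm, vecMulVec_mul_vecMulVec, ghz_dotProduct hk,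
    vecMulVec_smul, smul_smul, one_div, smul_smul, mul_assoc, inv_mul_cancel₀ hd', mul_one]

theorem trace_partialTranspose (S : Finset (Fin k)) (X : Op k d) :
    (partialTranspose S X).trace = X.trace := by
  simp [trace, partialTranspose, Finset.piecewise_same]

/-- Exchanging the `S`-coordinates of row and column is an involution on index pairs, hence only
permutes the terms of the trace. -/
theorem trace_partialTranspose_mul (S : Finset (Fin k)) (X Y : Op k d) :
    (partialTranspose S X * partialTranspose S Y).trace = (X * Y).trace := by
  have hinv : Function.Involutive (fun a : (Fin k → Fin d) × (Fin k → Fin d) =>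
      (S.piecewise a.2 a.1, S.piecewise a.1 a.2)) := by
    rintro ⟨a, b⟩
    ext i <;> by_cases hi : i ∈ S <;> simp [hi]
  simp only [trace, diag_apply, mul_apply, partialTranspose, of_apply]
  rw [← Fintype.sum_prod_type', ← Fintype.sum_prod_type']
  exact Equiv.sum_comp hinv.toPerm (fun a : (Fin k → Fin d) × (Fin k → Fin d) => X a.1 a.2 * Y a.2 a.1)

theorem partialTranspose_ghz (S : Finset (Fin k)) :
    partialTranspose S (ghz k d) = (1 / (d : ℂ)) • ∑ x : Fin d × Fin d,
      Matrix.single (S.piecewise (fun _ => x.1) (fun _ => x.2))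
        (S.piecewise (fun _ => x.2) (fun _ => x.1)) (1 : ℂ) := by
  ext a b
  simp only [partialTranspose, ghz, of_apply, Matrix.smul_apply, Matrix.sum_apply, single_apply]
  rw [← Fintype.sum_prod_type', ← (Equiv.prodComm (Fin d) (Fin d)).sum_comp]
  congr 1
  refine Finset.sum_congr rfl fun x _ => ?_
  refine if_congr ?_ rfl rfl
  simp only [funext_iff, Equiv.prodComm_apply, Prod.fst_swap, Prod.snd_swap, ← forall_and]
  refine forall_congr' fun i => ?_
  by_cases hi : i ∈ S <;> simp [hi, and_comm]

/-- Such a sum is a partial permutation `V`, and `V Vᴴ` is the diagonal projection onto the range of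
`e`. -/
theorem posSemidef_one_sub_sum_single {ι n : Type*} [Fintype ι] [DecidableEq ι] [Fintype n]
    [DecidableEq n] (e f : ι → n) (he : Function.Injective e) (hf : Function.Injective f) :
    (1 - (∑ x, Matrix.single (e x) (f x) (1 : ℂ)) *
      (∑ x, Matrix.single (e x) (f x) (1 : ℂ))ᴴ).PosSemidef := by
  have h1 : (∑ x, Matrix.single (e x) (f x) (1 : ℂ)) *
      (∑ x, Matrix.single (e x) (f x) (1 : ℂ))ᴴ = ∑ x, Matrix.single (e x) (e x) (1 : ℂ) := by
    rw [conjTranspose_sum, Finset.sum_mul_sum]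
    refine Finset.sum_congr rfl fun x _ => ?_
    rw [Finset.sum_eq_single x]
    · simp
    · intro y _ hy
      rw [conjTranspose_single, single_mul_single_of_ne]
      exact hf.ne hy.symm
    · simp
  have h2 : 1 - ∑ x, Matrix.single (e x) (e x) (1 : ℂ)
      = diagonal (fun a => 1 - ∑ x, if e x = a then (1 : ℂ) else 0) := by
    ext a b
    by_cases hab : a = b
    · subst hab
      simp [Matrix.sum_apply, single_apply]
    · simp only [Matrix.sub_apply, Matrix.sum_apply, single_apply, one_apply_ne hab,
        diagonal_apply_ne _ hab, zero_sub, neg_eq_zero]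
      refine Finset.sum_eq_zero fun x _ => if_neg ?_
      rintro ⟨rfl, rfl⟩
      exact hab rfl
  rw [h1, h2, posSemidef_diagonal_iff]
  intro a
  by_cases ha : ∃ y, e y = a
  · obtain ⟨y, rfl⟩ := ha
    simp [he.eq_iff]
  · push Not at ha
    simp [ha]

/-- The partial transpose of the GHZ state across a bipartition has operator norm `1 / d`. -/
theorem norm_trace_ghz_mul_le (hk : 2 ≤ k) (m : Bipartition k) (X : Op k d) :
    ‖(ghz k d * X).trace‖ ≤ 1 / (d : ℝ) * traceNorm (partialTranspose m.1 X) := by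
  obtain ⟨S, ⟨i, hi⟩, hS⟩ := m
  have h0 : (⟨0, by omega⟩ : Fin k) ∉ S := fun h => hS _ h rfl
  -- Both blocks are nonempty: party `i` reads off `x.1` and party 0 reads off `x.2`.
  have he : Function.Injective (fun x : Fin d × Fin d =>
      (S.piecewise (fun _ => x.1) (fun _ => x.2) : Fin k → Fin d)) := by
    intro x y h
    have h1 := congrFun h i
    have h2 := congrFun h ⟨0, by omega⟩
    simp only [Finset.piecewise_eq_of_mem _ _ _ hi, Finset.piecewise_eq_of_notMem _ _ _ h0] at h1 h2
    exact Prod.ext h1 h2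
  rw [← trace_partialTranspose_mul S, partialTranspose_ghz, smul_mul_assoc, trace_smul, norm_smul]
  have hn : ‖(1 / (d : ℂ))‖ = 1 / (d : ℝ) := by simp
  rw [hn]
  exact mul_le_mul_of_nonneg_left (norm_trace_mul_le_traceNorm
    (posSemidef_one_sub_sum_single _ _ he (he.comp Prod.swap_injective)) _) (by positivity)

/-- Partial transposition preserves the trace, which the trace norm dominates. -/
theorem one_le_traceNorm_partialTranspose (S : Finset (Fin k)) {ω : Op k d} (hω : IsState ω) :
    1 ≤ traceNorm (partialTranspose S ω) := by
  have h := norm_trace_mul_le_traceNorm (V := 1) (by simpa using PosSemidef.zero)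
    (partialTranspose S ω)
  rwa [one_mul, trace_partialTranspose, hω.2, norm_one] at h

theorem trace_ghz_mul_sum_le (hk : 2 ≤ k) (q : Bipartition k → ℝ) (t : Bipartition k → Op k d)
    (hq : ∀ m, 0 ≤ q m) :
    (ghz k d * ∑ m, q m • t m).trace.re ≤
      1 / (d : ℝ) * ∑ m, q m * traceNorm (partialTranspose m.1 (t m)) := by
  rw [Finset.mul_sum, trace_sum, Complex.re_sum, Finset.mul_sum]
  refine Finset.sum_le_sum fun m _ => ?_
  rw [mul_smul_comm, trace_smul, Complex.real_smul, Complex.re_ofReal_mul, mul_left_comm]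
  exact mul_le_mul_of_nonneg_left
    ((Complex.re_le_norm _).trans (norm_trace_ghz_mul_le hk m (t m))) (hq m)

end GHZ

/-! ### Binary relative entropy -/

section Binary

theorem classicalRelEntropy_binary {F u : ℝ} (hu : 0 < u) (hF1 : F ≤ 1) (huF : u ≤ F) :
    classicalRelEntropy ![F, 1 - F] ![u, 1 - u] =
      ((F * Real.logb 2 (F / u) + (1 - F) * Real.logb 2 ((1 - F) / (1 - u)) : ℝ) : EReal) := by
  rw [classicalRelEntropy, if_pos]
  · simp
  · intro i hi
    fin_cases i
    · simpa using hu.ne'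
    · simp only [Function.mem_support] at hi ⊢
      simp at hi ⊢
      intro h
      exact hi (by linarith)

/-- Lowering the second argument of the binary relative entropy below the first increases it. -/
theorem binary_relEntropy_le {F u s N : ℝ} (hu : 0 < u) (hu1 : u < 1) (huF : u ≤ F) (hF1 : F < 1)
    (hs : 0 < s) (hN : 0 < N) (hsN : s ≤ u * N) :
    F * Real.logb 2 (F / u) + (1 - F) * Real.logb 2 ((1 - F) / (1 - u)) ≤
      F * Real.logb 2 (F / s) + (1 - F) * Real.logb 2 ((1 - F) / (N - s)) + Real.logb 2 N := by
  have hF : 0 < F := hu.trans_le huF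
  have hF' : 0 < 1 - F := by linarith
  have hu' : 0 < 1 - u := by linarith
  have hNs : 0 < N - s := by nlinarith
  have hl2 : 0 < Real.log 2 := Real.log_pos (by norm_num)
  have h1 := Real.log_le_sub_one_of_pos (show 0 < s / (u * N) by positivity)
  have h2 := Real.log_le_sub_one_of_pos (show 0 < (N - s) / ((1 - u) * N) by positivity)
  rw [Real.log_div hs.ne' (by positivity), Real.log_mul hu.ne' hN.ne'] at h1
  rw [Real.log_div hNs.ne' (by positivity), Real.log_mul hu'.ne' hN.ne'] at h2
  -- After `log z ≤ z - 1` on both ratios, the bound is linear in `s`, zero at `s = u N`, with slope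
  -- of the sign of `F - u`.
  have h3 : F * (s / (u * N) - 1) + (1 - F) * ((N - s) / ((1 - u) * N) - 1) ≤ 0 := by
    have : F * (s / (u * N) - 1) + (1 - F) * ((N - s) / ((1 - u) * N) - 1)
        = (F - u) * (s - u * N) / (u * (1 - u) * N) := by
      field_simp
      ring
    rw [this]
    exact div_nonpos_of_nonpos_of_nonneg
      (mul_nonpos_of_nonneg_of_nonpos (by linarith) (by linarith)) (by positivity)
  simp only [Real.logb]
  rw [Real.log_div hF.ne' hu.ne', Real.log_div hF'.ne' hu'.ne', Real.log_div hF.ne' hs.ne',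
    Real.log_div hF'.ne' hNs.ne']
  simp only [← mul_div_assoc, ← add_div]
  refine div_le_div_of_nonneg_right ?_ hl2.le
  nlinarith [mul_le_mul_of_nonneg_left h1 hF.le, mul_le_mul_of_nonneg_left h2 hF'.le]

end Binary

/-! ### Assembly of the bounds -/

theorem binary_le_gmre_term {k d : ℕ} (hk : 2 ≤ k) (hd : 1 ≤ d) {ρ : Op k d} (hρ : IsState ρ)
    {F : ℝ} (hF : (ghz k d * ρ).trace.re = F) (hF1 : F ≤ 1) (hdF : 1 / (d : ℝ) ≤ F)
    (r : Bipartition k → ℝ) (ω : Bipartition k → Op k d) (hr : ∀ m, 0 ≤ r m) (hr1 : ∑ m, r m = 1)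
    (hω : ∀ m, IsState (ω m)) :
    ((F * Real.logb 2 (F / (1 / (d : ℝ))) +
        (1 - F) * Real.logb 2 ((1 - F) / (1 - 1 / (d : ℝ))) : ℝ) : EReal) ≤
      quantumRelEntropy ρ (∑ m, r m • ω m) +
        ((Real.logb 2 (∑ m, r m * traceNorm (partialTranspose m.1 (ω m))) : ℝ) : EReal) := by
  have hd0 : (0 : ℝ) < d := by exact_mod_cast hd
  have hu : 0 < 1 / (d : ℝ) := by positivity
  have hF0 : 0 < F := hu.trans_le hdF
  have hsN := trace_ghz_mul_sum_le hk r ω hr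
  set σ := ∑ m, r m • ω m with hσ
  set N := ∑ m, r m * traceNorm (partialTranspose m.1 (ω m)) with hN
  set s := (ghz k d * σ).trace.re with hs
  have hN1 : 1 ≤ N := by
    rw [← hr1]
    exact Finset.sum_le_sum fun m _ =>
      le_mul_of_one_le_right (hr m) (one_le_traceNorm_partialTranspose _ (hω m))
  have hσp : σ.PosSemidef := posSemidef_sum _ fun m _ => (hω m).1.smul (hr m)
  have hσt : σ.trace = 1 := by
    rw [hσ, trace_sum]
    simp only [trace_smul, (hω _).2, Complex.real_smul, mul_one]
    exact_mod_cast hr1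
  by_cases hsupp : support ρ ≤ support σ
  swap
  · rw [quantumRelEntropy, if_neg hsupp, EReal.top_add_coe]
    exact le_top
  have hs0 : 0 < s := trace_projection_mul_pos ghz_isHermitian (ghz_mul_self hk hd) hσp hsupp
    (hF ▸ hF0)
  have hs' : ((1 - ghz k d) * σ).trace.re = 1 - s := by
    rw [sub_mul, one_mul, trace_sub, hσt, Complex.sub_re, Complex.one_re]
  have key : ∀ y, 0 < y → 1 - s ≤ y → _ := fun y hy hsy =>
    add_le_add_left (binary_le_quantumRelEntropy hρ hσp ghz_isHermitian (ghz_mul_self hk hd) hF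
      hF0.le hF1 hs0 hy le_rfl (hs'.trans_le hsy)) ((Real.logb 2 N : ℝ) : EReal)
  rcases eq_or_lt_of_le hF1 with rfl | hF1
  -- For `F = 1` the second term vanishes, so any positive `y ≥ 1 - s` serves; `N - s` could be zero
  -- when `d = 1`.
  · refine le_trans ?_ (key (max 1 (1 - s)) (by positivity) (le_max_right _ _))
    rw [← EReal.coe_add, EReal.coe_le_coe_iff]
    simp only [one_mul, sub_self, zero_mul, add_zero]
    rw [← Real.logb_mul (by positivity) (by positivity)]
    refine Real.logb_le_logb_of_le (by norm_num) (by positivity) ?_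
    rw [one_div_mul_eq_div, le_div_iff₀ hd0] at hsN
    rw [one_div_one_div, one_div_mul_eq_div, le_div_iff₀ hs0]
    linarith
  · have hu1 : 1 / (d : ℝ) < 1 := hdF.trans_lt hF1
    -- Here `1/d < 1` forces `s < N`, and `N ≥ 1` gives `1 - s ≤ N - s`.
    refine le_trans ?_ (key (N - s) (by nlinarith) (by linarith))
    rw [← EReal.coe_add, EReal.coe_le_coe_iff]
    exact binary_relEntropy_le hu hu1 hdF hF1 hs0 (by linarith) hsN

/-- For `F < 1` the gap is `-(1 - F) log₂ (1 - 1/d)`, which is nonnegative. -/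
theorem mul_logb_sub_binaryEntropy_le {d : ℕ} (hd : 1 ≤ d) {F : ℝ} (hF0 : 0 < F) (hF1 : F ≤ 1)
    (hdF : 1 / (d : ℝ) ≤ F) :
    F * Real.logb 2 d - binaryEntropy F ≤
      F * Real.logb 2 (F / (1 / (d : ℝ))) +
        (1 - F) * Real.logb 2 ((1 - F) / (1 - 1 / (d : ℝ))) := by
  have hd0 : (0 : ℝ) < d := by exact_mod_cast hd
  rw [binaryEntropy, div_div_eq_mul_div, div_one, Real.logb_mul hF0.ne' hd0.ne']
  rcases eq_or_lt_of_le hF1 with rfl | hF1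
  · simp
  · have hu1 : 1 / (d : ℝ) < 1 := hdF.trans_lt hF1
    have hu : 0 < 1 / (d : ℝ) := by positivity
    have h1 : Real.logb 2 (1 - 1 / (d : ℝ)) ≤ 0 :=
      Real.logb_nonpos (by norm_num) (by linarith) (by linarith)
    rw [Real.logb_div (by linarith) (by linarith)]
    nlinarith

end GMRE

open GMRE in
theorem lemma1 (k d : ℕ) (hk : 2 ≤ k) (hd : 1 ≤ d) :
    (∀ ρ : GMRE.Op k d, GMRE.IsState ρ →
      ∀ F : ℝ, F = GMRE.fidelity (GMRE.ghz k d) ρ → 1 / (d : ℝ) ≤ F →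
        GMRE.classicalRelEntropy ![F, 1 - F] ![1 / (d : ℝ), 1 - 1 / (d : ℝ)] ≤ GMRE.gmre ρ ∧
        ((F * Real.logb 2 d - GMRE.binaryEntropy F : ℝ) : EReal) ≤
          GMRE.classicalRelEntropy ![F, 1 - F] ![1 / (d : ℝ), 1 - 1 / (d : ℝ)]) ∧
    (∀ σ ∈ GMRE.setT k d, (GMRE.ghz k d * σ).trace.re ≤ 1 / (d : ℝ)) := by
  have hd0 : (0 : ℝ) < d := by exact_mod_cast hd
  have hu : 0 < 1 / (d : ℝ) := by positivity
  have hP := ghz_isHermitian (k := k) (d := d)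
  have hPP := ghz_mul_self hk hd
  refine ⟨fun ρ hρ F hF hdF => ?_, ?_⟩
  · rw [fidelity_of_rank_one hP hPP ghz_mul_mul_ghz hρ.1] at hF
    have hF1 : F ≤ 1 := by
      have h := (Complex.le_def.1 (trace_projection_mul_nonneg
        (Matrix.isHermitian_one.sub hP) (by simp [mul_sub, sub_mul, hPP]) hρ.1)).1
      rw [sub_mul, one_mul, Matrix.trace_sub, hρ.2, Complex.sub_re, Complex.one_re, ← hF,
        Complex.zero_re] at h
      linarith
    rw [classicalRelEntropy_binary hu hF1 hdF]
    refine ⟨le_sInf ?_, ?_⟩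
    · rintro x ⟨r, ω, hr, hr1, hω, rfl⟩
      exact binary_le_gmre_term hk hd hρ hF.symm hF1 hdF r ω hr hr1 hω
    · exact EReal.coe_le_coe_iff.2 (mul_logb_sub_binaryEntropy_le hd (hu.trans_le hdF) hF1 hdF)
  · rintro σ ⟨q, t, hq, -, rfl, hqt⟩
    exact (trace_ghz_mul_sum_le hk q t hq).trans (mul_le_of_le_one_right hu.le hqt)
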